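/- **Theorem (Mayer–Vietoris for closure spaces).** A (Čech) closure space is a set $X$ with a map $c:2^X\to 2^X$ such that $c(\varnothing)=\varnothing$, $S\subset c(S)$ and $c(S\cup T)=c(S)\cup c(T)$ for all $S,T\subset X$; its interior operation is $i(S)=X\setminus c(X\setminus S)$. A map $f:(X,c)\to(Y,d)$ is continuous if $f(c(S))\subset d(f(S))$ for all $S\subset X$. A subset $A\subset X$ carries the subspace closure $c_A(S)=A\cap c(S)$, $S\subset A$. Let $C_n(X)$ be the free abelian group on the continuous maps $\sigma:|\Delta^n|\to X$ from the standard simplex $|\Delta^n|\subset\mathbb R^{n+1}$ with its usual topology, with boundary $\partial\sigma=\sum_{i=0}^n(-1)^i\,\sigma|_{[e_0,\dots,\hat e_i,\dots,e_n]}$, and let $H_n(X)$ be the homology of this chain complex. Let $(X,c)$ be a closure space and let $A,B\subset X$ be such that $\{A,B\}$ is an interior cover of $X$, that is, $i(A)\cup i(B)=X$. Give $A$, $B$ and $A\cap B$ the subspace closures. Then there are homomorphisms $\delta_n:H_n(X)\to H_{n-1}(A\cap B)$ $(n\ge 1)$ such that the sequence $$\cdots\to H_n(A\cap B)\xrightarrow{\varphi_*}H_n(A)\oplus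 H_n(B)\xrightarrow{\psi_*}H_n(X)\xrightarrow{\delta_n}H_{n-1}(A\cap B)\to\cdots\to H_0(A)\oplus H_0(B)\xrightarrow{\psi_*}H_0(X)\to 0$$ is exact, where $\varphi_*(x)=(j^A_*x,-j^B_*x)$ and $\psi_*(x,y)=k^A_*x+k^B_*y$ for the inclusions $j^A:A\cap B\to A$, $j^B:A\cap B\to B$, $k^A:A\to X$, $k^B:B\to X$. Moreover, $\delta_n$ is the usual connecting homomorphism: if a cycle $z\in C_n(X)$ is the sum of (the images of) chains $a\in C_n(A)$ and $b\in C_n(B)$, and $w\in C_{n-1}(A\cap B)$ is a cycle whose image in $C_{n-1}(A)$ is $\partial a$, then $\delta_n[z]=[w]$. -/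

import Mathlib

open CategoryTheory

universe u

/-- A (Čech) closure operator on `X`: idempotency is not required. -/
@[ext]
structure CechClosure (X : Type u) where
  /-- The closure of a set. -/
  cl : Set X → Set X
  cl_empty : cl ∅ = ∅
  subset_cl : ∀ A : Set X, A ⊆ cl A
  cl_union : ∀ A B : Set X, cl (A ∪ B) = cl A ∪ cl B

namespace CechClosure

/-- The interior operation `i(A) = X \ c(X \ A)`. -/
def int {X : Type u} (c : CechClosure X) (A : Set X) : Set X := (c.cl Aᶜ)ᶜ

/-- `U` is a neighbourhood of `x` if `x ∈ i(U)`. -/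
def IsNeighborhood {X : Type u} (c : CechClosure X) (x : X) (U : Set X) : Prop := x ∈ c.int U

/-- A family `𝒰` of subsets of `X` is an interior cover if every point of `X` has a neighbourhood
that belongs to `𝒰`. (Since `i(U) ⊆ U`, such a family covers `X`.) -/
def IsInteriorCover {X : Type u} (c : CechClosure X) (𝒰 : Set (Set X)) : Prop :=
  ∀ x : X, ∃ U ∈ 𝒰, c.IsNeighborhood x U

/-- Continuity of a map of closure spaces: `f(c(A)) ⊆ d(f(A))` for every `A`. -/
def IsContinuous {X Y : Type*} (c : CechClosure X) (d : CechClosure Y) (f : X → Y) : Prop :=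
  ∀ A : Set X, f '' c.cl A ⊆ d.cl (f '' A)

/-- The closure operator of a topological space. -/
def ofTopology (X : Type u) [TopologicalSpace X] : CechClosure X where
  cl := closure
  cl_empty := closure_empty
  subset_cl _ := subset_closure
  cl_union _ _ := closure_union

/-- The subspace closure operator `c_A(B) = A ∩ c(B)` for `B ⊆ A`; subsets of `A` are sets in the
subtype `↥A`. -/
def subspace {X : Type u} (c : CechClosure X) (A : Set X) : CechClosure A where
  cl B := Subtype.val ⁻¹' c.cl (Subtype.val '' B)
  cl_empty := by simp [c.cl_empty]
  subset_cl B x hx := c.subset_cl _ ⟨x, hx, rfl⟩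
  cl_union B B' := by simp [Set.image_union, c.cl_union]

theorem cl_mono {X : Type u} (c : CechClosure X) {A B : Set X} (h : A ⊆ B) : c.cl A ⊆ c.cl B := by
  rw [← Set.union_eq_self_of_subset_left h, c.cl_union]
  exact Set.subset_union_left

theorem IsContinuous.comp {X Y Z : Type*} {c : CechClosure X} {d : CechClosure Y}
    {e : CechClosure Z} {g : Y → Z} {f : X → Y} (hg : d.IsContinuous e g)
    (hf : c.IsContinuous d f) : c.IsContinuous e (g ∘ f) := by
  intro A
  rw [Set.image_comp, Set.image_comp]
  exact (Set.image_mono (hf A)).trans (hg _)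

theorem isContinuous_ofTopology {X Y : Type*} [TopologicalSpace X] [TopologicalSpace Y]
    {f : X → Y} (hf : Continuous f) : (ofTopology X).IsContinuous (ofTopology Y) f :=
  fun _ => image_closure_subset_closure_image hf

/-- For `A ⊆ B ⊆ X`, the inclusion of the subspace `A` into the subspace `B` is continuous. -/
theorem isContinuous_inclusion {X : Type u} (c : CechClosure X) {A B : Set X} (h : A ⊆ B) :
    (c.subspace A).IsContinuous (c.subspace B) (Set.inclusion h) := by
  rintro S _ ⟨x, hx, rfl⟩
  change (x : X) ∈ c.cl _
  rw [← Set.image_comp]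
  exact hx

/-- The inclusion of a subspace into the whole space is continuous. -/
theorem isContinuous_val {X : Type u} (c : CechClosure X) (A : Set X) :
    (c.subspace A).IsContinuous c Subtype.val := by
  rintro S _ ⟨x, hx, rfl⟩
  exact hx

/-- Singular `n`-simplices of a closure space: the continuous maps to it from the standard
`n`-simplex `{t ∈ ℝⁿ⁺¹ | tᵢ ≥ 0, ∑ tᵢ = 1}` with its usual topology. -/
def SingularSimplex {X : Type u} (c : CechClosure X) (n : ℕ) : Type u :=
  {σ : stdSimplex ℝ (Fin (n + 1)) → X // (ofTopology _).IsContinuous c σ}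

/-- The `i`-th face of a singular simplex: its restriction to `[e_0, …, ê_i, …, e_{n+1}]`, that is,
its composition with the affine map of standard simplices that sends the vertices of the `n`-simplex
in order to the vertices other than `e_i`. -/
noncomputable def SingularSimplex.face {X : Type u} {c : CechClosure X} {n : ℕ} (i : Fin (n + 2))
    (σ : SingularSimplex c (n + 1)) : SingularSimplex c n :=
  ⟨σ.1 ∘ stdSimplex.map i.succAbove,
    σ.2.comp (isContinuous_ofTopology (stdSimplex.continuous_map _))⟩

theorem SingularSimplex.face_face {X : Type u} {c : CechClosure X} {n : ℕ} {i j : Fin (n + 2)}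
    (h : i ≤ j) (σ : SingularSimplex c (n + 2)) :
    (σ.face j.succ).face i = (σ.face i.castSucc).face j := by
  refine Subtype.ext (funext fun t => congrArg σ.1 ?_)
  refine (stdSimplex.map_comp_apply _ _ t).trans
    (Eq.trans ?_ (stdSimplex.map_comp_apply _ _ t).symm)
  refine congrArg (fun θ => stdSimplex.map θ t) (funext fun k => ?_)
  simp only [Function.comp_apply, Fin.succAbove, Fin.lt_def, Fin.ext_iff, Fin.le_def] at h ⊢
  split_ifs <;> simp_all <;> omega

/-- The boundary `∂ : C_{n+1}(X) → C_n(X)`, the homomorphism with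
`∂σ = ∑ i, (-1)ⁱ (i-th face of σ)`. -/
noncomputable def boundary {X : Type u} (c : CechClosure X) (n : ℕ) :
    (SingularSimplex c (n + 1) →₀ ℤ) →ₗ[ℤ] (SingularSimplex c n →₀ ℤ) :=
  Finsupp.linearCombination ℤ fun σ =>
    ∑ i : Fin (n + 2), Finsupp.single (σ.face i) ((-1 : ℤ) ^ (i : ℕ))

theorem boundary_single {X : Type u} (c : CechClosure X) (n : ℕ) (σ : SingularSimplex c (n + 1))
    (k : ℤ) : c.boundary n (Finsupp.single σ k) =
      k • ∑ i : Fin (n + 2), Finsupp.single (σ.face i) ((-1 : ℤ) ^ (i : ℕ)) :=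
  Finsupp.linearCombination_single ℤ k σ

theorem boundary_comp_boundary {X : Type u} (c : CechClosure X) (n : ℕ) :
    c.boundary n ∘ₗ c.boundary (n + 1) = 0 := by
  refine Finsupp.lhom_ext' fun σ => LinearMap.ext_ring ?_
  simp only [LinearMap.comp_apply, Finsupp.lsingle_apply, boundary_single, one_smul, map_sum,
    Finset.smul_sum, Finsupp.smul_single, smul_eq_mul, LinearMap.zero_apply]
  rw [← Finset.sum_product']
  let P := Fin (n + 3) × Fin (n + 2)
  let S : Finset P := {ij : P | (ij.1 : ℕ) ≤ (ij.2 : ℕ)}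
  rw [Finset.univ_product_univ, ← Finset.sum_add_sum_compl S, ← eq_neg_iff_add_eq_zero,
    ← Finset.sum_neg_distrib]
  refine Finset.sum_bij (fun ij hij => (ij.2.succ,
    Fin.castLT ij.1 (lt_of_le_of_lt (Finset.mem_filter.mp hij).right (Fin.is_lt ij.2)))) ?_ ?_ ?_ ?_
  · intro ij hij
    simp_rw [S, Finset.compl_filter, Finset.mem_filter_univ, Fin.val_succ, Fin.val_castLT] at hij ⊢
    omega
  · rintro ⟨i, j⟩ hij ⟨i', j'⟩ hij' h
    have h1 := congrArg (fun p => (p.1 : ℕ)) h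
    have h2 := congrArg (fun p => (p.2 : ℕ)) h
    simp only [Fin.val_succ, Fin.val_castLT] at h1 h2
    have h3 : (j : ℕ) = j' := Nat.succ_injective h1
    exact Prod.ext (Fin.ext h2) (Fin.ext h3)
  · rintro ⟨i, j⟩ hij
    simp_rw [S, Finset.compl_filter, Finset.mem_filter_univ, not_le] at hij
    refine ⟨(j.castSucc, i.pred fun h => by simp [h] at hij), ?_, ?_⟩
    · simp [S]
      omega
    · simp
  · rintro ⟨i, j⟩ hij
    simp only [S, Finset.mem_filter_univ] at hij
    have h := SingularSimplex.face_face
      (i := i.castLT (lt_of_le_of_lt hij j.isLt)) (j := j) (by simpa [Fin.le_def] using hij) σ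
    simp only [Fin.castSucc_castLT] at h
    simp only [h, Fin.val_succ, Fin.val_castLT, ← Finsupp.single_neg]
    congr 1
    ring

/-- The singular chain complex `C_•(X)` of a closure space; `C_n(X)` is the free abelian group on
the singular `n`-simplices. -/
noncomputable def singularChains {X : Type u} (c : CechClosure X) :
    ChainComplex (ModuleCat.{u} ℤ) ℕ :=
  ChainComplex.of (fun n => ModuleCat.of ℤ (SingularSimplex c n →₀ ℤ))
    (fun n => ModuleCat.ofHom (c.boundary n))
    (fun n => ModuleCat.hom_ext (c.boundary_comp_boundary n))

theorem singularChains_d {X : Type u} (c : CechClosure X) (n : ℕ) :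
    c.singularChains.d (n + 1) n = ModuleCat.ofHom (c.boundary n) :=
  ChainComplex.of_d (fun n => ModuleCat.of ℤ (SingularSimplex c n →₀ ℤ))
    (fun n => ModuleCat.ofHom (c.boundary n)) n

/-- The singular simplex `f ∘ σ`, for a continuous map `f`. -/
def SingularSimplex.push {X Y : Type u} {c : CechClosure X} {d : CechClosure Y} (f : X → Y)
    (hf : c.IsContinuous d f) {n : ℕ} (σ : SingularSimplex c n) : SingularSimplex d n :=
  ⟨f ∘ σ.1, hf.comp σ.2⟩

theorem boundary_mapDomain_push {X Y : Type u} {c : CechClosure X} {d : CechClosure Y} (f : X → Y)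
    (hf : c.IsContinuous d f) (n : ℕ) :
    d.boundary n ∘ₗ Finsupp.lmapDomain ℤ ℤ (SingularSimplex.push f hf) =
      Finsupp.lmapDomain ℤ ℤ (SingularSimplex.push f hf) ∘ₗ c.boundary n := by
  refine Finsupp.lhom_ext' fun σ => LinearMap.ext_ring ?_
  simp only [LinearMap.comp_apply, Finsupp.lsingle_apply, Finsupp.lmapDomain_apply,
    Finsupp.mapDomain_single, boundary_single, one_smul, Finsupp.mapDomain_finsetSum]
  rfl

/-- The chain map `f_# : C_•(X) → C_•(Y)`, `σ ↦ f ∘ σ`, induced by a continuous map `f`. -/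
noncomputable def singularChainsMap {X Y : Type u} {c : CechClosure X} {d : CechClosure Y}
    (f : X → Y) (hf : c.IsContinuous d f) : c.singularChains ⟶ d.singularChains :=
  ChainComplex.ofHom
    (fun n => ModuleCat.ofHom (Finsupp.lmapDomain ℤ ℤ (SingularSimplex.push (n := n) f hf)))
    (fun n => ModuleCat.hom_ext (by
      simpa [singularChains] using! boundary_mapDomain_push f hf n))

/-- The `n`-th singular homology group `H_n(X)` of a closure space. -/
noncomputable def H {X : Type u} (c : CechClosure X) (n : ℕ) : ModuleCat.{u} ℤ :=
  c.singularChains.homology n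

/-- The homomorphism `f_* : H_n(X) → H_n(Y)` induced by a continuous map. -/
noncomputable def HMap {X Y : Type u} {c : CechClosure X} {d : CechClosure Y} (f : X → Y)
    (hf : c.IsContinuous d f) (n : ℕ) : c.H n →+ d.H n :=
  (HomologicalComplex.homologyMap (singularChainsMap f hf) n).hom.toAddMonoidHom

/-- The homology class of an `n`-cycle. -/
noncomputable def homologyClass {X : Type u} (c : CechClosure X) (n : ℕ) :
    c.singularChains.cycles n →+ c.H n :=
  (c.singularChains.homologyπ n).hom.toAddMonoidHom

/-- The chain underlying an `n`-cycle. -/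
noncomputable def cycleChain {X : Type u} (c : CechClosure X) (n : ℕ) :
    c.singularChains.cycles n →+ (SingularSimplex c n →₀ ℤ) :=
  (c.singularChains.iCycles n).hom.toAddMonoidHom

/-- The homomorphism on chains induced by an inclusion of subspaces `A ⊆ B`. -/
noncomputable def chainsInclusion {X : Type u} (c : CechClosure X) {A B : Set X} (h : A ⊆ B)
    (n : ℕ) :
    (SingularSimplex (c.subspace A) n →₀ ℤ) →ₗ[ℤ] (SingularSimplex (c.subspace B) n →₀ ℤ) :=
  Finsupp.lmapDomain ℤ ℤ (SingularSimplex.push (Set.inclusion h) (c.isContinuous_inclusion h))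

/-- The homomorphism on chains induced by the inclusion of a subspace `A` into `X`. -/
noncomputable def chainsVal {X : Type u} (c : CechClosure X) (A : Set X) (n : ℕ) :
    (SingularSimplex (c.subspace A) n →₀ ℤ) →ₗ[ℤ] (SingularSimplex c n →₀ ℤ) :=
  Finsupp.lmapDomain ℤ ℤ (SingularSimplex.push Subtype.val (c.isContinuous_val A))

/-- The homomorphism `H_n(A) → H_n(B)` induced by an inclusion of subspaces `A ⊆ B`. -/
noncomputable def HInclusion {X : Type u} (c : CechClosure X) {A B : Set X} (h : A ⊆ B) (n : ℕ) :
    (c.subspace A).H n →+ (c.subspace B).H n :=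
  HMap (Set.inclusion h) (c.isContinuous_inclusion h) n

/-- The homomorphism `H_n(A) → H_n(X)` induced by the inclusion of a subspace. -/
noncomputable def HVal {X : Type u} (c : CechClosure X) (A : Set X) (n : ℕ) :
    (c.subspace A).H n →+ c.H n :=
  HMap Subtype.val (c.isContinuous_val A) n

/-- `H_n(A ∩ B) → H_n(A) ⊕ H_n(B)`, `x ↦ (x, -x)`. -/
noncomputable def mvPhi {X : Type u} (c : CechClosure X) (A B : Set X) (n : ℕ) :
    (c.subspace (A ∩ B)).H n →+ (c.subspace A).H n × (c.subspace B).H n :=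
  AddMonoidHom.prod (c.HInclusion Set.inter_subset_left n) (-c.HInclusion Set.inter_subset_right n)

/-- `H_n(A) ⊕ H_n(B) → H_n(X)`, `(x, y) ↦ x + y`. -/
noncomputable def mvPsi {X : Type u} (c : CechClosure X) (A B : Set X) (n : ℕ) :
    (c.subspace A).H n × (c.subspace B).H n →+ c.H n :=
  AddMonoidHom.coprod (c.HVal A n) (c.HVal B n)

end CechClosure

/-!
The theorem is a formal consequence of two facts about the chains of `X`. First, a singular
simplex of `X` with image in `A` is the same thing as a singular simplex of the subspace `A`, so
chains of `A` and of `B` that agree in `X` come from `A ∩ B`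
(`CechClosure.exists_chainsInclusion_eq`), and the sums of chains of `A` and of `B` are the small
chains, those whose simplices each lie in `A` or in `B` (`CechClosure.exists_eq_chainsVal_add`).
Secondly, a chain with small boundary is small up to a boundary
(`CechClosure.IsInteriorCover.exists_sub_boundary_mem`), that is, the inclusion of the small
chains is a quasi-isomorphism. Given these, the connecting homomorphism and the exactness are the
usual chase on cycles.

The second fact is proved by barycentric subdivision, which is done once and for all for tuples of
points of a standard simplex, regarded as affine simplices, and is carried to singular chains by
naturality. On tuples, the subdivision `S` and the homotopy `T` from `S` to the identity are
defined by recursion on the dimension, as cones from the barycentre over `S ∂v` and over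
`v - T ∂v`; working with augmented chains makes the cone formula `∂ (y * x) = x - y * ∂x` the only
computation needed. Subdivision shrinks the diameter of an affine `n`-simplex by the factor
`n / (n + 1)`.

The closure structure enters the subdivision argument at one place only. The target of a singular
simplex `σ` is not a topological space, but its source is: continuity of `σ` makes `σ⁻¹(U)` a
neighbourhood of every point that `σ` takes into the interior of `U`
(`CechClosure.IsContinuous.preimage_mem_nhds`). Hence the interiors of `σ⁻¹(A)` and `σ⁻¹(B)` form
an open cover of a compact metric space, and the Lebesgue number lemma shows that an iterated
subdivision of `σ` is small.
-/

/-! ### Cycles and homology classes -/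

namespace CechClosure

/-- The singular `n`-chains that are cycles; every `0`-chain is one. -/
noncomputable def cycleChains {X : Type u} (c : CechClosure X) :
    ∀ n : ℕ, Submodule ℤ (SingularSimplex c n →₀ ℤ)
  | 0 => ⊤
  | n + 1 => LinearMap.ker (c.boundary n)

section HomologyClasses

variable {X Y : Type u} {c : CechClosure X} {d : CechClosure Y}

theorem cycleChain_injective (n : ℕ) : Function.Injective (c.cycleChain n) :=
  (ModuleCat.mono_iff_injective (c.singularChains.iCycles n)).1 inferInstance

theorem homologyClass_surjective (n : ℕ) : Function.Surjective (c.homologyClass n) :=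
  (ModuleCat.epi_iff_surjective (c.singularChains.homologyπ n)).1 inferInstance

theorem cycleChain_mem_cycleChains (n : ℕ) (z : c.singularChains.cycles n) :
    c.cycleChain n z ∈ c.cycleChains n := by
  cases n with
  | zero => trivial
  | succ n =>
    have h := ConcreteCategory.congr_hom (c.singularChains.iCycles_d (n + 1) n) z
    rw [singularChains_d] at h
    exact h

theorem boundary_mem_cycleChains (n : ℕ) (y : SingularSimplex c (n + 1) →₀ ℤ) :
    c.boundary n y ∈ c.cycleChains n := by
  cases n with
  | zero => trivial
  | succ n => exact LinearMap.congr_fun (c.boundary_comp_boundary n) y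

theorem mapDomain_push_mem_cycleChains {f : X → Y} (hf : c.IsContinuous d f) {n : ℕ}
    {x : SingularSimplex c n →₀ ℤ} (hx : x ∈ c.cycleChains n) :
    Finsupp.lmapDomain ℤ ℤ (SingularSimplex.push f hf) x ∈ d.cycleChains n := by
  cases n with
  | zero => trivial
  | succ n =>
    refine (LinearMap.congr_fun (boundary_mapDomain_push f hf n) x).trans ?_
    rw [LinearMap.comp_apply, show c.boundary n x = 0 from hx, map_zero]

theorem exists_cycleChain_eq (n : ℕ) {x : SingularSimplex c n →₀ ℤ} (hx : x ∈ c.cycleChains n) :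
    ∃ z : c.singularChains.cycles n, c.cycleChain n z = x := by
  -- A chain is the image of a generator under a map `k` from a copy of `ℤ` in the universe of `X`,
  -- and `k` factors through the cycles if the chain is a cycle.
  let k : ModuleCat.of ℤ (ULift.{u} ℤ) ⟶ c.singularChains.X n :=
    ModuleCat.ofHom ((LinearMap.toSpanSingleton ℤ (SingularSimplex c n →₀ ℤ) x).comp
      ULift.moduleEquiv.toLinearMap)
  have hk : k ≫ c.singularChains.d n ((ComplexShape.down ℕ).next n) = 0 := by
    cases n with
    | zero => rw [c.singularChains.shape _ _ (by simp), Limits.comp_zero]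
    | succ n =>
      rw [ChainComplex.next_nat_succ, singularChains_d]
      refine ModuleCat.hom_ext (LinearMap.ext fun r => ?_)
      change c.boundary n (r.down • x) = 0
      rw [map_smul, show c.boundary n x = 0 from hx, smul_zero]
  refine ⟨c.singularChains.liftCycles k _ rfl hk ⟨1⟩, ?_⟩
  refine (ConcreteCategory.congr_hom (c.singularChains.liftCycles_i k _ rfl hk) ⟨1⟩).trans ?_
  exact one_smul ℤ x

theorem homologyClass_eq_zero_iff (n : ℕ) (z : c.singularChains.cycles n) :
    c.homologyClass n z = 0 ↔ ∃ y, c.boundary n y = c.cycleChain n z := by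
  have key : ∀ y, c.cycleChain n (c.singularChains.toCycles (n + 1) n y) = c.boundary n y := by
    intro y
    refine (ConcreteCategory.congr_hom (c.singularChains.toCycles_i (n + 1) n) y).trans ?_
    rw [singularChains_d]
    rfl
  let S := ShortComplex.mk _ _ (c.singularChains.toCycles_comp_homologyπ (n + 1) n)
  have hS : S.Exact := S.exact_of_g_is_cokernel
    (c.singularChains.homologyIsCokernel (n + 1) n (by simp))
  rw [ShortComplex.moduleCat_exact_iff] at hS
  constructor
  · intro h
    obtain ⟨y, hy⟩ := hS z h
    exact ⟨y, by rw [← key, ← hy]⟩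
  · rintro ⟨y, hy⟩
    rw [← cycleChain_injective n ((key y).trans hy)]
    exact ConcreteCategory.congr_hom (c.singularChains.toCycles_comp_homologyπ (n + 1) n) y

theorem homologyClass_eq_iff (n : ℕ) (z z' : c.singularChains.cycles n) :
    c.homologyClass n z = c.homologyClass n z' ↔
      ∃ y, c.boundary n y = c.cycleChain n z - c.cycleChain n z' := by
  rw [← sub_eq_zero, ← map_sub, homologyClass_eq_zero_iff, map_sub]

theorem HMap_homologyClass {f : X → Y} (hf : c.IsContinuous d f) (n : ℕ)
    {z : c.singularChains.cycles n} {z' : d.singularChains.cycles n}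
    (h : Finsupp.lmapDomain ℤ ℤ (SingularSimplex.push f hf) (c.cycleChain n z) =
      d.cycleChain n z') :
    HMap f hf n (c.homologyClass n z) = d.homologyClass n z' := by
  have h1 := ConcreteCategory.congr_hom
    (HomologicalComplex.homologyπ_naturality (singularChainsMap f hf) n) z
  have h2 := ConcreteCategory.congr_hom
    (HomologicalComplex.cyclesMap_i (singularChainsMap f hf) n) z
  have h3 : HomologicalComplex.cyclesMap (singularChainsMap f hf) n z = z' :=
    cycleChain_injective n (h2.trans h)
  exact h1.trans (congrArg (d.homologyClass n) h3)

theorem HMap_homologyClass_eq_iff {f : X → Y} (hf : c.IsContinuous d f) (n : ℕ)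
    (z : c.singularChains.cycles n) (z' : d.singularChains.cycles n) :
    HMap f hf n (c.homologyClass n z) = d.homologyClass n z' ↔
      ∃ y, d.boundary n y = Finsupp.lmapDomain ℤ ℤ (SingularSimplex.push f hf) (c.cycleChain n z) -
        d.cycleChain n z' := by
  obtain ⟨z₁, h⟩ := exists_cycleChain_eq n
    (mapDomain_push_mem_cycleChains hf (cycleChain_mem_cycleChains n z))
  rw [HMap_homologyClass hf n h.symm, homologyClass_eq_iff, h]

end HomologyClasses
end CechClosure

/-! ### Subdivision of chains of tuples -/

namespace TupleChain

variable {Y Z : Type*}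

/-- The boundary of chains of tuples: the alternating sum of the tuples with one entry removed.
A tuple with `n + 1` entries has dimension `n`, so this is the augmented complex: in degree `0`
there is the empty tuple, and the boundary of a point is the empty tuple. -/
noncomputable def boundary (Y : Type*) (n : ℕ) :
    ((Fin (n + 1) → Y) →₀ ℤ) →ₗ[ℤ] ((Fin n → Y) →₀ ℤ) :=
  Finsupp.linearCombination ℤ fun v =>
    ∑ i : Fin (n + 1), Finsupp.single (v ∘ i.succAbove) ((-1 : ℤ) ^ (i : ℕ))

theorem boundary_single {n : ℕ} (v : Fin (n + 1) → Y) :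
    boundary Y n (Finsupp.single v 1) =
      ∑ i : Fin (n + 1), Finsupp.single (v ∘ i.succAbove) ((-1 : ℤ) ^ (i : ℕ)) := by
  simp [boundary]

/-- The cone with apex `y` over a chain of tuples: `y` is prepended to each tuple. -/
noncomputable def cone (y : Y) (n : ℕ) :
    ((Fin n → Y) →₀ ℤ) →ₗ[ℤ] ((Fin (n + 1) → Y) →₀ ℤ) :=
  Finsupp.lmapDomain ℤ ℤ fun v => (Fin.cons y v : Fin (n + 1) → Y)

theorem cone_single (y : Y) {n : ℕ} (v : Fin n → Y) (k : ℤ) :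
    cone y n (Finsupp.single v k) = Finsupp.single (Fin.cons y v) k :=
  Finsupp.mapDomain_single

theorem boundary_cone_zero (y : Y) (x : (Fin 0 → Y) →₀ ℤ) : boundary Y 0 (cone y 0 x) = x := by
  suffices h : boundary Y 0 ∘ₗ cone y 0 = LinearMap.id from LinearMap.congr_fun h x
  refine Finsupp.lhom_ext' fun v => LinearMap.ext_ring ?_
  simp only [LinearMap.comp_apply, Finsupp.lsingle_apply, LinearMap.id_apply, cone_single,
    boundary_single]
  rw [Fin.sum_univ_succ, Fin.sum_univ_zero, add_zero]
  exact congrArg₂ Finsupp.single (Subsingleton.elim _ _) rfl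

theorem boundary_cone_succ (y : Y) {n : ℕ} (x : (Fin (n + 1) → Y) →₀ ℤ) :
    boundary Y (n + 1) (cone y (n + 1) x) = x - cone y n (boundary Y n x) := by
  suffices h : boundary Y (n + 1) ∘ₗ cone y (n + 1) = LinearMap.id - cone y n ∘ₗ boundary Y n from
    LinearMap.congr_fun h x
  refine Finsupp.lhom_ext' fun v => LinearMap.ext_ring ?_
  simp only [LinearMap.comp_apply, Finsupp.lsingle_apply, LinearMap.id_apply, cone_single,
    LinearMap.sub_apply, boundary_single, map_sum]
  rw [Fin.sum_univ_succ, sub_eq_add_neg, ← Finset.sum_neg_distrib]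
  refine congrArg₂ _ ?_ ?_
  · have : (Fin.cons y v : Fin (n + 2) → Y) ∘ (0 : Fin (n + 2)).succAbove = v := by
      ext i; simp
    rw [this, Fin.val_zero, pow_zero]
  · refine Finset.sum_congr rfl fun i _ => ?_
    have : (Fin.cons y v : Fin (n + 2) → Y) ∘ i.succ.succAbove = Fin.cons y (v ∘ i.succAbove) := by
      ext j
      refine Fin.cases ?_ (fun j => ?_) j <;> simp
    rw [this, Fin.val_succ, pow_succ, mul_neg_one, Finsupp.single_neg]

theorem boundary_boundary {n : ℕ} (x : (Fin (n + 2) → Y) →₀ ℤ) :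
    boundary Y n (boundary Y (n + 1) x) = 0 := by
  induction n with
  | zero =>
    suffices h : boundary Y 0 ∘ₗ boundary Y 1 = 0 from LinearMap.congr_fun h x
    refine Finsupp.lhom_ext' fun v => LinearMap.ext_ring ?_
    simp only [LinearMap.comp_apply, Finsupp.lsingle_apply, LinearMap.zero_apply]
    rw [← Fin.cons_self_tail v, ← cone_single, boundary_cone_succ, map_sub, boundary_cone_zero,
      sub_self]
  | succ n ih =>
    suffices h : boundary Y (n + 1) ∘ₗ boundary Y (n + 2) = 0 from LinearMap.congr_fun h x
    refine Finsupp.lhom_ext' fun v => LinearMap.ext_ring ?_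
    simp only [LinearMap.comp_apply, Finsupp.lsingle_apply, LinearMap.zero_apply]
    rw [← Fin.cons_self_tail v, ← cone_single, boundary_cone_succ, map_sub, boundary_cone_succ, ih,
      map_zero, sub_zero, sub_self]

/-- The map on chains of tuples induced by a map of sets. -/
noncomputable def map (f : Y → Z) (n : ℕ) : ((Fin n → Y) →₀ ℤ) →ₗ[ℤ] ((Fin n → Z) →₀ ℤ) :=
  Finsupp.lmapDomain ℤ ℤ fun v => f ∘ v

theorem map_single (f : Y → Z) {n : ℕ} (v : Fin n → Y) (k : ℤ) :
    map f n (Finsupp.single v k) = Finsupp.single (f ∘ v) k :=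
  Finsupp.mapDomain_single

theorem map_boundary (f : Y → Z) {n : ℕ} (x : (Fin (n + 1) → Y) →₀ ℤ) :
    map f n (boundary Y n x) = boundary Z n (map f (n + 1) x) := by
  suffices h : map f n ∘ₗ boundary Y n = boundary Z n ∘ₗ map f (n + 1) from
    LinearMap.congr_fun h x
  refine Finsupp.lhom_ext' fun v => LinearMap.ext_ring ?_
  simp only [LinearMap.comp_apply, Finsupp.lsingle_apply, map_single, boundary_single, map_sum]
  rfl

theorem map_cone (f : Y → Z) (y : Y) {n : ℕ} (x : (Fin n → Y) →₀ ℤ) :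
    map f (n + 1) (cone y n x) = cone (f y) n (map f n x) := by
  suffices h : map f (n + 1) ∘ₗ cone y n = cone (f y) n ∘ₗ map f n from LinearMap.congr_fun h x
  refine Finsupp.lhom_ext' fun v => LinearMap.ext_ring ?_
  simp only [LinearMap.comp_apply, Finsupp.lsingle_apply, map_single, cone_single]
  congr 1
  ext j
  refine Fin.cases ?_ (fun j => ?_) j <;> simp

section Subdivision

variable (β : ∀ n : ℕ, (Fin (n + 1) → Y) → Y)

/-- The subdivision of chains of tuples with respect to a choice `β` of a centre for each nonempty
tuple: a tuple goes to the cone from its centre over the subdivision of its boundary. -/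
noncomputable def subdivision : ∀ n : ℕ, ((Fin n → Y) →₀ ℤ) →ₗ[ℤ] ((Fin n → Y) →₀ ℤ)
  | 0 => LinearMap.id
  | n + 1 => Finsupp.linearCombination ℤ fun v =>
      cone (β n v) n (subdivision n (boundary Y n (Finsupp.single v 1)))

/-- The chain homotopy from the subdivision to the identity: a tuple `v` goes to the cone from its
centre over `v` minus the homotopy of its boundary. -/
noncomputable def homotopy : ∀ n : ℕ, ((Fin n → Y) →₀ ℤ) →ₗ[ℤ] ((Fin (n + 1) → Y) →₀ ℤ)
  | 0 => 0
  | n + 1 => Finsupp.linearCombination ℤ fun v =>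
      cone (β n v) (n + 1) (Finsupp.single v 1 - homotopy n (boundary Y n (Finsupp.single v 1)))

theorem subdivision_succ_single {n : ℕ} (v : Fin (n + 1) → Y) :
    subdivision β (n + 1) (Finsupp.single v 1) =
      cone (β n v) n (subdivision β n (boundary Y n (Finsupp.single v 1))) := by
  simp [subdivision]

theorem homotopy_succ_single {n : ℕ} (v : Fin (n + 1) → Y) :
    homotopy β (n + 1) (Finsupp.single v 1) = cone (β n v) (n + 1)
      (Finsupp.single v 1 - homotopy β n (boundary Y n (Finsupp.single v 1))) := by
  simp [homotopy]

theorem boundary_subdivision {n : ℕ} (x : (Fin (n + 1) → Y) →₀ ℤ) :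
    boundary Y n (subdivision β (n + 1) x) = subdivision β n (boundary Y n x) := by
  induction n with
  | zero =>
    suffices h : boundary Y 0 ∘ₗ subdivision β 1 = subdivision β 0 ∘ₗ boundary Y 0 from
      LinearMap.congr_fun h x
    refine Finsupp.lhom_ext' fun v => LinearMap.ext_ring ?_
    simp only [LinearMap.comp_apply, Finsupp.lsingle_apply]
    rw [subdivision_succ_single, boundary_cone_zero]
  | succ n ih =>
    suffices h : boundary Y (n + 1) ∘ₗ subdivision β (n + 2) =
        subdivision β (n + 1) ∘ₗ boundary Y (n + 1) from LinearMap.congr_fun h x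
    refine Finsupp.lhom_ext' fun v => LinearMap.ext_ring ?_
    simp only [LinearMap.comp_apply, Finsupp.lsingle_apply]
    rw [subdivision_succ_single, boundary_cone_succ, ih, boundary_boundary, map_zero, map_zero,
      sub_zero]

theorem boundary_homotopy {n : ℕ} (x : (Fin (n + 1) → Y) →₀ ℤ) :
    boundary Y (n + 1) (homotopy β (n + 1) x) + homotopy β n (boundary Y n x) =
      x - subdivision β (n + 1) x := by
  induction n with
  | zero =>
    suffices h : boundary Y 1 ∘ₗ homotopy β 1 + homotopy β 0 ∘ₗ boundary Y 0 =
        LinearMap.id - subdivision β 1 from LinearMap.congr_fun h x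
    refine Finsupp.lhom_ext' fun v => LinearMap.ext_ring ?_
    simp only [LinearMap.comp_apply, Finsupp.lsingle_apply, LinearMap.add_apply,
      LinearMap.sub_apply, LinearMap.id_apply]
    rw [homotopy_succ_single, boundary_cone_succ, subdivision_succ_single]
    simp [homotopy, subdivision]
  | succ n ih =>
    suffices h : boundary Y (n + 2) ∘ₗ homotopy β (n + 2) +
        homotopy β (n + 1) ∘ₗ boundary Y (n + 1) = LinearMap.id - subdivision β (n + 2) from
      LinearMap.congr_fun h x
    refine Finsupp.lhom_ext' fun v => LinearMap.ext_ring ?_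
    simp only [LinearMap.comp_apply, Finsupp.lsingle_apply, LinearMap.add_apply,
      LinearMap.sub_apply, LinearMap.id_apply]
    have h := ih (boundary Y (n + 1) (Finsupp.single v 1))
    rw [boundary_boundary, map_zero, add_zero] at h
    rw [homotopy_succ_single, boundary_cone_succ, subdivision_succ_single, map_sub (boundary _ _),
      h, sub_sub_cancel]
    abel

theorem map_subdivision {γ : ∀ n : ℕ, (Fin (n + 1) → Z) → Z} {f : Y → Z}
    (hf : ∀ n v, f (β n v) = γ n (f ∘ v)) {n : ℕ} (x : (Fin n → Y) →₀ ℤ) :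
    map f n (subdivision β n x) = subdivision γ n (map f n x) := by
  induction n with
  | zero => rfl
  | succ n ih =>
    suffices h : map f (n + 1) ∘ₗ subdivision β (n + 1) =
        subdivision γ (n + 1) ∘ₗ map f (n + 1) from LinearMap.congr_fun h x
    refine Finsupp.lhom_ext' fun v => LinearMap.ext_ring ?_
    simp only [LinearMap.comp_apply, Finsupp.lsingle_apply]
    rw [subdivision_succ_single, map_cone, ih, map_boundary, map_single, subdivision_succ_single,
      hf]

theorem map_homotopy {γ : ∀ n : ℕ, (Fin (n + 1) → Z) → Z} {f : Y → Z}
    (hf : ∀ n v, f (β n v) = γ n (f ∘ v)) {n : ℕ} (x : (Fin n → Y) →₀ ℤ) :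
    map f (n + 1) (homotopy β n x) = homotopy γ n (map f n x) := by
  induction n with
  | zero => simp [homotopy]
  | succ n ih =>
    suffices h : map f (n + 2) ∘ₗ homotopy β (n + 1) =
        homotopy γ (n + 1) ∘ₗ map f (n + 1) from LinearMap.congr_fun h x
    refine Finsupp.lhom_ext' fun v => LinearMap.ext_ring ?_
    simp only [LinearMap.comp_apply, Finsupp.lsingle_apply]
    rw [homotopy_succ_single, map_cone, map_sub, ih, map_boundary, map_single,
      homotopy_succ_single, hf]

end Subdivision

/-- A linear map out of a free module sends chains supported in `s` into a submodule `N` as soon as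
it does so for the generators in `s`. -/
theorem map_mem_of_mem_supported {α M : Type*} [AddCommGroup M] (F : (α →₀ ℤ) →ₗ[ℤ] M)
    {s : Set α} {N : Submodule ℤ M} (h : ∀ a ∈ s, F (Finsupp.single a 1) ∈ N) {x : α →₀ ℤ}
    (hx : x ∈ Finsupp.supported ℤ ℤ s) : F x ∈ N := by
  rw [Finsupp.supported_eq_span_single] at hx
  refine (Submodule.span_le (p := N.comap F)).2 ?_ hx
  rintro _ ⟨a, ha, rfl⟩
  exact h a ha

section Mesh

variable [PseudoMetricSpace Y] {β : ∀ n : ℕ, (Fin (n + 1) → Y) → Y}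

/-- The tuples of a subdivision of `v` lie in every closed ball that contains `v`, and their
diameter is smaller than that of `v` by a factor that depends only on the dimension. -/
theorem subdivision_single_mem_supported
    (hβ : ∀ n v p r, (∀ i, dist (v i) p ≤ r) → dist (β n v) p ≤ r)
    (hβ' : ∀ n v D, (∀ i j, dist (v i) (v j) ≤ D) →
      ∀ i, dist (v i) (β n v) ≤ n / (n + 1) * D) (N : ℕ) {n : ℕ} (hn : n ≤ N + 1)
    (v : Fin n → Y) (D : ℝ) (hv : ∀ i j, dist (v i) (v j) ≤ D) :
    subdivision β n (Finsupp.single v 1) ∈ Finsupp.supported ℤ ℤ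
      {w : Fin n → Y | (∀ i j, dist (w i) (w j) ≤ N / (N + 1) * D) ∧
        ∀ p r, (∀ i, dist (v i) p ≤ r) → ∀ i, dist (w i) p ≤ r} := by
  induction n with
  | zero => exact Finsupp.single_mem_supported ℤ 1 ⟨fun i => i.elim0, fun _ _ _ i => i.elim0⟩
  | succ n ih =>
    have hD : 0 ≤ D := dist_nonneg.trans (hv 0 0)
    have hq : (n : ℝ) / (n + 1) * D ≤ N / (N + 1) * D := by
      refine mul_le_mul_of_nonneg_right ?_ hD
      have h : (n : ℝ) ≤ N := by exact_mod_cast Nat.le_of_succ_le_succ hn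
      rw [div_le_div_iff₀ (by positivity) (by positivity)]
      linarith
    rw [subdivision_succ_single, boundary_single, map_sum, map_sum]
    refine Submodule.sum_mem _ fun i _ => ?_
    rw [← Finsupp.smul_single_one, map_smul, map_smul]
    refine Submodule.smul_mem _ _ ?_
    refine map_mem_of_mem_supported _ (fun w hw => ?_)
      (ih (by omega) (v ∘ i.succAbove) fun j k => hv _ _)
    rw [cone_single]
    obtain ⟨hw, hw'⟩ := hw
    have hc : ∀ j, dist (w j) (β n v) ≤ N / (N + 1) * D :=
      hw' _ _ fun j => (hβ' n v D hv _).trans hq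
    refine Finsupp.single_mem_supported ℤ 1 ⟨fun j k => ?_, fun p r hp j => ?_⟩
    · refine Fin.cases ?_ (fun j => ?_) j <;> refine Fin.cases ?_ (fun k => ?_) k
      · simp only [dist_self]; positivity
      · rw [dist_comm]; exact hc k
      · exact hc j
      · exact hw j k
    · refine Fin.cases ?_ (fun j => ?_) j
      · exact hβ n v p r hp
      · exact hw' p r (fun j => hp _) j

theorem subdivision_iterate_single_mem_supported
    (hβ : ∀ n v p r, (∀ i, dist (v i) p ≤ r) → dist (β n v) p ≤ r)
    (hβ' : ∀ n v D, (∀ i j, dist (v i) (v j) ≤ D) →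
      ∀ i, dist (v i) (β n v) ≤ n / (n + 1) * D) {n : ℕ}
    (v : Fin (n + 1) → Y) (D : ℝ) (hv : ∀ i j, dist (v i) (v j) ≤ D) (N : ℕ) :
    (subdivision β (n + 1))^[N] (Finsupp.single v 1) ∈ Finsupp.supported ℤ ℤ
      {w : Fin (n + 1) → Y | ∀ i j, dist (w i) (w j) ≤ (n / (n + 1)) ^ N * D} := by
  induction N with
  | zero => exact Finsupp.single_mem_supported ℤ 1 (by simpa using hv)
  | succ N ih =>
    rw [Function.iterate_succ_apply']
    refine map_mem_of_mem_supported _ (fun w hw => ?_) ih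
    refine Finsupp.supported_mono (fun u hu => ?_)
      (subdivision_single_mem_supported hβ hβ' n le_rfl w _ hw)
    rw [Set.mem_ofPred_eq, pow_succ', mul_assoc]
    exact hu.1

end Mesh

end TupleChain

/-! ### Affine simplices in a standard simplex -/

namespace stdSimplex

variable {ι κ μ : Type*} [Fintype ι] [Fintype κ] [Fintype μ]

/-- The affine map of standard simplices that sends the `i`-th vertex to `v i`. -/
noncomputable def comb (v : ι → stdSimplex ℝ κ) (t : stdSimplex ℝ ι) : stdSimplex ℝ κ :=
  ⟨∑ i, t i • (v i).1,
    (convex_stdSimplex ℝ κ).sum_mem (fun i _ => t.2.1 i) t.2.2 fun i _ => (v i).2⟩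

theorem comb_apply (v : ι → stdSimplex ℝ κ) (t : stdSimplex ℝ ι) (k : κ) :
    comb v t k = ∑ i, t i * v i k :=
  (Finset.sum_apply _ _ _).trans rfl

theorem continuous_comb (v : ι → stdSimplex ℝ κ) : Continuous (comb v) := by
  refine Continuous.subtype_mk (continuous_finsetSum _ fun i _ => ?_) _
  exact ((continuous_apply i).comp continuous_subtype_val).smul continuous_const

theorem comb_vertex [DecidableEq ι] (t : stdSimplex ℝ ι) : comb vertex t = t := by
  ext k
  simp [comb_apply, Pi.single_apply]

theorem comb_vertex_apply [DecidableEq ι] (v : ι → stdSimplex ℝ κ) (i : ι) :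
    comb v (vertex i) = v i := by
  ext k
  simp [comb_apply, Pi.single_apply]

theorem comb_comb (w : κ → stdSimplex ℝ μ) (v : ι → stdSimplex ℝ κ) (t : stdSimplex ℝ ι) :
    comb w (comb v t) = comb (fun i => comb w (v i)) t := by
  ext k
  simp only [comb_apply, Finset.sum_mul, Finset.mul_sum]
  rw [Finset.sum_comm]
  simp only [mul_assoc]

theorem comb_map (v : κ → stdSimplex ℝ μ) (f : ι → κ) (t : stdSimplex ℝ ι) :
    comb v (map f t) = comb (v ∘ f) t := by
  classical
  ext k
  simp only [comb_apply, map_coe, FunOnFinite.linearMap_apply_apply, Finset.sum_mul,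
    Function.comp_apply]
  rw [← Finset.sum_fiberwise Finset.univ f]
  refine Finset.sum_congr rfl fun j _ => Finset.sum_congr rfl fun i hi => ?_
  rw [(Finset.mem_filter.1 hi).2]

/-- Closed balls of a standard simplex are stable under convex combinations. -/
theorem dist_comb_le {v : ι → stdSimplex ℝ κ} {p : stdSimplex ℝ κ} {r : ℝ}
    (h : ∀ i, dist (v i) p ≤ r) (t : stdSimplex ℝ ι) : dist (comb v t) p ≤ r :=
  (convex_closedBall (E := κ → ℝ) p.1 r).sum_mem (fun i _ => t.2.1 i) t.2.2 fun i _ => h i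

theorem dist_comb_barycenter_le {n : ℕ} (v : Fin (n + 1) → stdSimplex ℝ κ) (D : ℝ)
    (h : ∀ i j, dist (v i) (v j) ≤ D) (i : Fin (n + 1)) :
    dist (v i) (comb v barycenter) ≤ n / (n + 1) * D := by
  have hn : (n : ℝ) + 1 ≠ 0 := by positivity
  have key : (v i).1 - (comb v barycenter).1 =
      ((n : ℝ) + 1)⁻¹ • ∑ j : Fin n, ((v i).1 - (v (i.succAbove j)).1) := by
    have hb : (comb v barycenter).1 = ((n : ℝ) + 1)⁻¹ • ∑ j, (v j).1 := by
      ext k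
      refine (comb_apply v barycenter k).trans ?_
      rw [Pi.smul_apply, Finset.sum_apply, smul_eq_mul, Finset.mul_sum]
      refine Finset.sum_congr rfl fun j _ => congrArg₂ (· * ·) ?_ rfl
      exact (barycenter_apply j).trans (by simp)
    rw [hb, Finset.sum_sub_distrib, Fin.sum_univ_succAbove _ i, Finset.sum_const, Finset.card_univ,
      Fintype.card_fin, eq_inv_smul_iff₀ hn, smul_sub, smul_inv_smul₀ hn, add_smul, one_smul,
      Nat.cast_smul_eq_nsmul]
    abel
  rw [Subtype.dist_eq, dist_eq_norm, key, norm_smul, norm_inv, Real.norm_of_nonneg (by positivity),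
    div_mul_eq_mul_div, div_eq_inv_mul]
  refine mul_le_mul_of_nonneg_left ?_ (by positivity)
  refine (norm_sum_le_of_le _ fun j _ => ?_).trans_eq
    (b := ∑ _j : Fin n, D) (by simp)
  rw [← dist_eq_norm]
  exact h _ _

/-- The barycentre of a nonempty tuple of points of a standard simplex. -/
noncomputable def center (κ : Type*) [Fintype κ] (n : ℕ) (v : Fin (n + 1) → stdSimplex ℝ κ) :
    stdSimplex ℝ κ :=
  comb v barycenter

theorem comb_center (w : κ → stdSimplex ℝ μ) (n : ℕ) (v : Fin (n + 1) → stdSimplex ℝ κ) :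
    comb w (center κ n v) = center μ n (comb w ∘ v) :=
  comb_comb w v _

end stdSimplex

/-! ### Barycentric subdivision of singular chains -/

namespace CechClosure

section SingularSubdivision

variable {X : Type u} {c : CechClosure X}

/-- The composition of a singular simplex `σ` with the affine simplex whose vertices are `v`. -/
noncomputable def SingularSimplex.affine {m n : ℕ} (σ : SingularSimplex c m)
    (v : Fin (n + 1) → stdSimplex ℝ (Fin (m + 1))) : SingularSimplex c n :=
  ⟨σ.1 ∘ stdSimplex.comb v, σ.2.comp (isContinuous_ofTopology (stdSimplex.continuous_comb v))⟩

theorem SingularSimplex.face_affine {m n : ℕ} (σ : SingularSimplex c m)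
    (v : Fin (n + 2) → stdSimplex ℝ (Fin (m + 1))) (i : Fin (n + 2)) :
    (σ.affine v).face i = σ.affine (v ∘ i.succAbove) :=
  Subtype.ext (funext fun t => congrArg σ.1 (stdSimplex.comb_map v _ t))

theorem SingularSimplex.affine_vertex {n : ℕ} (σ : SingularSimplex c n) :
    σ.affine stdSimplex.vertex = σ :=
  Subtype.ext (funext fun t => congrArg σ.1 (stdSimplex.comb_vertex t))

theorem SingularSimplex.affine_affine {l m n : ℕ} (σ : SingularSimplex c l)
    (v : Fin (m + 1) → stdSimplex ℝ (Fin (l + 1))) (w : Fin (n + 1) → stdSimplex ℝ (Fin (m + 1))) :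
    (σ.affine v).affine w = σ.affine (stdSimplex.comb v ∘ w) :=
  Subtype.ext (funext fun t => congrArg σ.1 (stdSimplex.comb_comb v w t))

/-- The map `σ_#` from affine chains of the standard simplex to singular chains. -/
noncomputable def affineChain {m : ℕ} (σ : SingularSimplex c m) (n : ℕ) :
    ((Fin (n + 1) → stdSimplex ℝ (Fin (m + 1))) →₀ ℤ) →ₗ[ℤ] (SingularSimplex c n →₀ ℤ) :=
  Finsupp.lmapDomain ℤ ℤ σ.affine

theorem affineChain_single {m n : ℕ} (σ : SingularSimplex c m)
    (v : Fin (n + 1) → stdSimplex ℝ (Fin (m + 1))) (k : ℤ) :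
    affineChain σ n (Finsupp.single v k) = Finsupp.single (σ.affine v) k :=
  Finsupp.mapDomain_single

theorem affineChain_vertex {n : ℕ} (σ : SingularSimplex c n) :
    affineChain σ n (Finsupp.single stdSimplex.vertex 1) = Finsupp.single σ 1 := by
  rw [affineChain_single, SingularSimplex.affine_vertex]

theorem boundary_affineChain {m n : ℕ} (σ : SingularSimplex c m)
    (x : (Fin (n + 2) → stdSimplex ℝ (Fin (m + 1))) →₀ ℤ) :
    c.boundary n (affineChain σ (n + 1) x) =
      affineChain σ n (TupleChain.boundary _ (n + 1) x) := by
  suffices h : c.boundary n ∘ₗ affineChain σ (n + 1) =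
      affineChain σ n ∘ₗ TupleChain.boundary _ (n + 1) from LinearMap.congr_fun h x
  refine Finsupp.lhom_ext' fun v => LinearMap.ext_ring ?_
  simp only [LinearMap.comp_apply, Finsupp.lsingle_apply, affineChain_single, boundary_single,
    TupleChain.boundary_single, one_smul, map_sum, SingularSimplex.face_affine]

theorem affineChain_affine {l m n : ℕ} (σ : SingularSimplex c l)
    (v : Fin (m + 1) → stdSimplex ℝ (Fin (l + 1)))
    (x : (Fin (n + 1) → stdSimplex ℝ (Fin (m + 1))) →₀ ℤ) :
    affineChain (σ.affine v) n x =
      affineChain σ n (TupleChain.map (stdSimplex.comb v) (n + 1) x) := by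
  suffices h : affineChain (σ.affine v) n =
      affineChain σ n ∘ₗ TupleChain.map (stdSimplex.comb v) (n + 1) from LinearMap.congr_fun h x
  refine Finsupp.lhom_ext' fun w => LinearMap.ext_ring ?_
  simp only [LinearMap.comp_apply, Finsupp.lsingle_apply, affineChain_single,
    TupleChain.map_single, SingularSimplex.affine_affine]

/-- The barycentric subdivision of singular chains. -/
noncomputable def subdivision (c : CechClosure X) (n : ℕ) :
    (SingularSimplex c n →₀ ℤ) →ₗ[ℤ] (SingularSimplex c n →₀ ℤ) :=
  Finsupp.linearCombination ℤ fun σ => affineChain σ n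
    (TupleChain.subdivision (stdSimplex.center _) (n + 1) (Finsupp.single stdSimplex.vertex 1))

/-- The chain homotopy from the barycentric subdivision of singular chains to the identity. -/
noncomputable def subdivisionHomotopy (c : CechClosure X) (n : ℕ) :
    (SingularSimplex c n →₀ ℤ) →ₗ[ℤ] (SingularSimplex c (n + 1) →₀ ℤ) :=
  Finsupp.linearCombination ℤ fun σ => affineChain σ (n + 1)
    (TupleChain.homotopy (stdSimplex.center _) (n + 1) (Finsupp.single stdSimplex.vertex 1))

theorem subdivision_single {n : ℕ} (σ : SingularSimplex c n) :
    c.subdivision n (Finsupp.single σ 1) = affineChain σ n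
      (TupleChain.subdivision (stdSimplex.center _) (n + 1)
        (Finsupp.single stdSimplex.vertex 1)) := by
  simp [subdivision]

theorem subdivisionHomotopy_single {n : ℕ} (σ : SingularSimplex c n) :
    c.subdivisionHomotopy n (Finsupp.single σ 1) = affineChain σ (n + 1)
      (TupleChain.homotopy (stdSimplex.center _) (n + 1)
        (Finsupp.single stdSimplex.vertex 1)) := by
  simp [subdivisionHomotopy]

theorem subdivision_affineChain {m n : ℕ} (σ : SingularSimplex c m)
    (x : (Fin (n + 1) → stdSimplex ℝ (Fin (m + 1))) →₀ ℤ) :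
    c.subdivision n (affineChain σ n x) =
      affineChain σ n (TupleChain.subdivision (stdSimplex.center _) (n + 1) x) := by
  suffices h : c.subdivision n ∘ₗ affineChain σ n =
      affineChain σ n ∘ₗ TupleChain.subdivision (stdSimplex.center _) (n + 1) from
    LinearMap.congr_fun h x
  refine Finsupp.lhom_ext' fun v => LinearMap.ext_ring ?_
  simp only [LinearMap.comp_apply, Finsupp.lsingle_apply]
  rw [affineChain_single, subdivision_single, affineChain_affine,
    TupleChain.map_subdivision _ (stdSimplex.comb_center v), TupleChain.map_single]
  exact congrArg (fun w => affineChain σ n (TupleChain.subdivision _ _ (Finsupp.single w 1)))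
    (funext (stdSimplex.comb_vertex_apply v))

theorem subdivisionHomotopy_affineChain {m n : ℕ} (σ : SingularSimplex c m)
    (x : (Fin (n + 1) → stdSimplex ℝ (Fin (m + 1))) →₀ ℤ) :
    c.subdivisionHomotopy n (affineChain σ n x) =
      affineChain σ (n + 1) (TupleChain.homotopy (stdSimplex.center _) (n + 1) x) := by
  suffices h : c.subdivisionHomotopy n ∘ₗ affineChain σ n =
      affineChain σ (n + 1) ∘ₗ TupleChain.homotopy (stdSimplex.center _) (n + 1) from
    LinearMap.congr_fun h x
  refine Finsupp.lhom_ext' fun v => LinearMap.ext_ring ?_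
  simp only [LinearMap.comp_apply, Finsupp.lsingle_apply]
  rw [affineChain_single, subdivisionHomotopy_single, affineChain_affine,
    TupleChain.map_homotopy _ (stdSimplex.comb_center v), TupleChain.map_single]
  exact congrArg (fun w => affineChain σ (n + 1) (TupleChain.homotopy _ _ (Finsupp.single w 1)))
    (funext (stdSimplex.comb_vertex_apply v))

theorem boundary_subdivision {n : ℕ} (x : SingularSimplex c (n + 1) →₀ ℤ) :
    c.boundary n (c.subdivision (n + 1) x) = c.subdivision n (c.boundary n x) := by
  suffices h : c.boundary n ∘ₗ c.subdivision (n + 1) = c.subdivision n ∘ₗ c.boundary n from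
    LinearMap.congr_fun h x
  refine Finsupp.lhom_ext' fun σ => LinearMap.ext_ring ?_
  simp only [LinearMap.comp_apply, Finsupp.lsingle_apply]
  rw [← affineChain_vertex, subdivision_affineChain, boundary_affineChain, boundary_affineChain,
    subdivision_affineChain, TupleChain.boundary_subdivision]

theorem boundary_subdivisionHomotopy {n : ℕ} (x : SingularSimplex c (n + 1) →₀ ℤ) :
    c.boundary (n + 1) (c.subdivisionHomotopy (n + 1) x) +
      c.subdivisionHomotopy n (c.boundary n x) = x - c.subdivision (n + 1) x := by
  suffices h : c.boundary (n + 1) ∘ₗ c.subdivisionHomotopy (n + 1) +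
      c.subdivisionHomotopy n ∘ₗ c.boundary n = LinearMap.id - c.subdivision (n + 1) from
    LinearMap.congr_fun h x
  refine Finsupp.lhom_ext' fun σ => LinearMap.ext_ring ?_
  simp only [LinearMap.comp_apply, Finsupp.lsingle_apply, LinearMap.add_apply, LinearMap.sub_apply,
    LinearMap.id_apply]
  rw [← affineChain_vertex, subdivision_affineChain, subdivisionHomotopy_affineChain,
    boundary_affineChain, boundary_affineChain, subdivisionHomotopy_affineChain, ← map_add,
    ← map_sub, TupleChain.boundary_homotopy]

end SingularSubdivision

end CechClosure

/-! ### Small chains -/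

namespace CechClosure

section SmallChains

variable {X : Type u} {c : CechClosure X}

/-- If a continuous map from a topological space takes a point into the interior of `U`, then the
preimage of `U` is a neighbourhood of that point. -/
theorem IsContinuous.preimage_mem_nhds {T : Type*} [TopologicalSpace T] {f : T → X}
    (hf : (ofTopology T).IsContinuous c f) {U : Set X} {t : T} (h : c.IsNeighborhood (f t) U) :
    f ⁻¹' U ∈ nhds t := by
  rw [← mem_interior_iff_mem_nhds, interior_eq_compl_closure_compl]
  intro ht
  refine h (c.cl_mono ?_ (hf _ ⟨t, ht, rfl⟩))
  rintro _ ⟨s, hs, rfl⟩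
  exact hs

/-- The chains that are combinations of simplices each of which lies in a member of `𝒰`. -/
noncomputable def smallChains (c : CechClosure X) (𝒰 : Set (Set X)) (n : ℕ) :
    Submodule ℤ (SingularSimplex c n →₀ ℤ) :=
  Finsupp.supported ℤ ℤ {σ | ∃ U ∈ 𝒰, Set.range σ.1 ⊆ U}

variable {𝒰 : Set (Set X)}

theorem affineChain_mem_smallChains {m : ℕ} {σ : SingularSimplex c m}
    (hσ : ∃ U ∈ 𝒰, Set.range σ.1 ⊆ U) (n : ℕ)
    (x : (Fin (n + 1) → stdSimplex ℝ (Fin (m + 1))) →₀ ℤ) :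
    affineChain σ n x ∈ c.smallChains 𝒰 n := by
  obtain ⟨U, hU, hσ⟩ := hσ
  refine TupleChain.map_mem_of_mem_supported _ (s := Set.univ) (fun v _ => ?_) (by simp)
  rw [affineChain_single]
  exact Finsupp.single_mem_supported ℤ 1 ⟨U, hU, (Set.range_comp_subset_range _ σ.1).trans hσ⟩

theorem subdivision_mem_smallChains {n : ℕ} {x : SingularSimplex c n →₀ ℤ}
    (hx : x ∈ c.smallChains 𝒰 n) : c.subdivision n x ∈ c.smallChains 𝒰 n := by
  refine TupleChain.map_mem_of_mem_supported _ (fun σ hσ => ?_) hx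
  rw [subdivision_single]
  exact affineChain_mem_smallChains hσ _ _

theorem subdivisionHomotopy_mem_smallChains {n : ℕ} {x : SingularSimplex c n →₀ ℤ}
    (hx : x ∈ c.smallChains 𝒰 n) : c.subdivisionHomotopy n x ∈ c.smallChains 𝒰 (n + 1) := by
  refine TupleChain.map_mem_of_mem_supported _ (fun σ hσ => ?_) hx
  rw [subdivisionHomotopy_single]
  exact affineChain_mem_smallChains hσ _ _

theorem subdivision_iterate_mem_smallChains {n : ℕ} {x : SingularSimplex c n →₀ ℤ}
    (hx : x ∈ c.smallChains 𝒰 n) (N : ℕ) : (c.subdivision n)^[N] x ∈ c.smallChains 𝒰 n := by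
  induction N with
  | zero => exact hx
  | succ N ih =>
    rw [Function.iterate_succ_apply']
    exact subdivision_mem_smallChains ih

/-- Every simplex has a Lebesgue number with respect to an interior cover. -/
theorem IsInteriorCover.exists_lebesgueNumber (h𝒰 : c.IsInteriorCover 𝒰) {n : ℕ}
    (σ : SingularSimplex c n) :
    ∃ δ > 0, ∀ t, ∃ U ∈ 𝒰, Metric.ball t δ ⊆ σ.1 ⁻¹' U := by
  obtain ⟨δ, hδ, h⟩ := lebesgue_number_lemma_of_metric (s := Set.univ)
    (c := fun U : 𝒰 => interior (σ.1 ⁻¹' U.1)) isCompact_univ (fun _ => isOpen_interior)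
    fun t _ => by
      obtain ⟨U, hU, ht⟩ := h𝒰 (σ.1 t)
      exact Set.mem_iUnion.2 ⟨⟨U, hU⟩, mem_interior_iff_mem_nhds.2 (σ.2.preimage_mem_nhds ht)⟩
  refine ⟨δ, hδ, fun t => ?_⟩
  obtain ⟨U, hU⟩ := h t trivial
  exact ⟨U.1, U.2, hU.trans interior_subset⟩

theorem subdivision_iterate_affineChain {m n : ℕ} (σ : SingularSimplex c m)
    (x : (Fin (n + 1) → stdSimplex ℝ (Fin (m + 1))) →₀ ℤ) (N : ℕ) :
    (c.subdivision n)^[N] (affineChain σ n x) =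
      affineChain σ n ((TupleChain.subdivision (stdSimplex.center _) (n + 1))^[N] x) := by
  induction N with
  | zero => rfl
  | succ N ih => rw [Function.iterate_succ_apply', Function.iterate_succ_apply', ih,
      subdivision_affineChain]

theorem IsInteriorCover.exists_subdivision_iterate_single_mem (h𝒰 : c.IsInteriorCover 𝒰) {n : ℕ}
    (σ : SingularSimplex c n) :
    ∃ N : ℕ, (c.subdivision n)^[N] (Finsupp.single σ 1) ∈ c.smallChains 𝒰 n := by
  obtain ⟨δ, hδ, hU⟩ := h𝒰.exists_lebesgueNumber σ
  have hq : (n : ℝ) / (n + 1) < 1 := (div_lt_one (by positivity)).2 (lt_add_one _)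
  let D := Metric.diam (Set.univ : Set (stdSimplex ℝ (Fin (n + 1))))
  have hlim : Filter.Tendsto (fun N : ℕ => ((n : ℝ) / (n + 1)) ^ N * D) Filter.atTop (nhds 0) := by
    simpa using (tendsto_pow_atTop_nhds_zero_of_lt_one (by positivity) hq).mul_const D
  obtain ⟨N, hN⟩ := (hlim.eventually_lt_const hδ).exists
  refine ⟨N, ?_⟩
  rw [← affineChain_vertex, subdivision_iterate_affineChain]
  refine TupleChain.map_mem_of_mem_supported _ (fun v hv => ?_)
    (TupleChain.subdivision_iterate_single_mem_supported
      (fun _ _ _ _ h => stdSimplex.dist_comb_le h _) (fun _ => stdSimplex.dist_comb_barycenter_le)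
      _ D
      (fun i j => Metric.dist_le_diam_of_mem isCompact_univ.isBounded trivial trivial) N)
  obtain ⟨U, hU, hball⟩ := hU (v 0)
  rw [affineChain_single]
  refine Finsupp.single_mem_supported ℤ 1 ⟨U, hU, ?_⟩
  rintro _ ⟨t, rfl⟩
  exact hball ((stdSimplex.dist_comb_le (fun i => hv i 0) t).trans_lt hN)

theorem IsInteriorCover.exists_subdivision_iterate_mem (h𝒰 : c.IsInteriorCover 𝒰) {n : ℕ}
    (x : SingularSimplex c n →₀ ℤ) :
    ∃ N : ℕ, (c.subdivision n)^[N] x ∈ c.smallChains 𝒰 n := by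
  have hpow : ∀ N x, (c.subdivision n)^[N] x = (c.subdivision n ^ N) x := fun N x => by
    rw [Module.End.pow_apply]
  induction x using Finsupp.induction_linear with
  | zero => exact ⟨0, zero_mem _⟩
  | add x y hx hy =>
    obtain ⟨M, hM⟩ := hx
    obtain ⟨N, hN⟩ := hy
    refine ⟨M + N, ?_⟩
    rw [hpow, map_add, ← hpow, ← hpow]
    refine add_mem ?_ ?_
    · rw [add_comm, Function.iterate_add_apply]
      exact subdivision_iterate_mem_smallChains hM N
    · rw [Function.iterate_add_apply]
      exact subdivision_iterate_mem_smallChains hN M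
  | single σ k =>
    obtain ⟨N, hN⟩ := h𝒰.exists_subdivision_iterate_single_mem σ
    refine ⟨N, ?_⟩
    rw [hpow, ← Finsupp.smul_single_one, map_smul, ← hpow]
    exact Submodule.smul_mem _ _ hN

/-- The homology of the singular chains modulo the small chains vanishes in positive degrees: a
chain with small boundary is small up to a boundary. -/
theorem IsInteriorCover.exists_sub_boundary_mem (h𝒰 : c.IsInteriorCover 𝒰) {n : ℕ}
    {x : SingularSimplex c (n + 1) →₀ ℤ} (hx : c.boundary n x ∈ c.smallChains 𝒰 n) :
    ∃ y, x - c.boundary (n + 1) y ∈ c.smallChains 𝒰 (n + 1) := by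
  obtain ⟨N, hN⟩ := h𝒰.exists_subdivision_iterate_mem x
  induction N generalizing x with
  | zero => exact ⟨0, by simpa using hN⟩
  | succ N ih =>
    -- The chain `x` differs from its subdivision by `∂ T x` and the small chain `T ∂ x`, where `T`
    -- is the subdivision homotopy.
    obtain ⟨y, hy⟩ := ih (x := c.subdivision (n + 1) x)
      (by rw [boundary_subdivision]; exact subdivision_mem_smallChains hx) hN
    refine ⟨y + c.subdivisionHomotopy (n + 1) x, ?_⟩
    convert! add_mem hy (subdivisionHomotopy_mem_smallChains hx) using 1
    rw [map_add, eq_sub_of_add_eq (boundary_subdivisionHomotopy x)]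
    abel

/-- A singular `0`-simplex is a point, and so it lies in a member of an interior cover. -/
theorem IsInteriorCover.smallChains_zero (h𝒰 : c.IsInteriorCover 𝒰) : c.smallChains 𝒰 0 = ⊤ := by
  rw [smallChains, ← Finsupp.supported_univ]
  congr 1
  refine Set.eq_univ_of_forall fun σ => ?_
  obtain ⟨U, hU, h⟩ := h𝒰 (σ.1 default)
  refine ⟨U, hU, ?_⟩
  rintro _ ⟨t, rfl⟩
  rw [Subsingleton.elim t default]
  by_contra ht
  exact h (c.subset_cl _ ht)

end SmallChains

section Subspaces

variable {X : Type u} {c : CechClosure X}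

/-- A singular simplex whose image lies in `A`, as a singular simplex of the subspace `A`. -/
def SingularSimplex.codRestrict {n : ℕ} (σ : SingularSimplex c n) (A : Set X)
    (h : Set.range σ.1 ⊆ A) : SingularSimplex (c.subspace A) n :=
  ⟨fun t => ⟨σ.1 t, h ⟨t, rfl⟩⟩, by
    rintro S _ ⟨t, ht, rfl⟩
    change σ.1 t ∈ c.cl _
    rw [← Set.image_comp]
    exact σ.2 S ⟨t, ht, rfl⟩⟩

theorem chainsVal_injective (A : Set X) (n : ℕ) : Function.Injective (c.chainsVal A n) := by
  refine Finsupp.mapDomain_injective fun σ τ h => ?_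
  exact Subtype.ext (funext fun t => Subtype.ext (congrFun (congrArg Subtype.val h) t))

theorem range_chainsVal (A : Set X) (n : ℕ) :
    LinearMap.range (c.chainsVal A n) = Finsupp.supported ℤ ℤ {σ | Set.range σ.1 ⊆ A} := by
  rw [← Submodule.map_top, ← Finsupp.supported_univ, chainsVal, Finsupp.lmapDomain_supported,
    Set.image_univ]
  congr 1
  ext σ
  constructor
  · rintro ⟨τ, rfl⟩ _ ⟨t, rfl⟩
    exact (τ.1 t).2
  · exact fun h => ⟨σ.codRestrict A h, rfl⟩

theorem exists_eq_chainsVal_add {A B : Set X} {n : ℕ} {x : SingularSimplex c n →₀ ℤ}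
    (hx : x ∈ c.smallChains {A, B} n) : ∃ a b, x = c.chainsVal A n a + c.chainsVal B n b := by
  have h : c.smallChains {A, B} n =
      LinearMap.range (c.chainsVal A n) ⊔ LinearMap.range (c.chainsVal B n) := by
    rw [range_chainsVal, range_chainsVal, ← Finsupp.supported_union, smallChains]
    congr 1
    ext σ
    simp
  rw [h, Submodule.mem_sup] at hx
  obtain ⟨_, ⟨a, rfl⟩, _, ⟨b, rfl⟩, rfl⟩ := hx
  exact ⟨a, b, rfl⟩

theorem chainsVal_mem_smallChains {A : Set X} {𝒰 : Set (Set X)} (hA : A ∈ 𝒰) {n : ℕ}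
    (a : SingularSimplex (c.subspace A) n →₀ ℤ) : c.chainsVal A n a ∈ c.smallChains 𝒰 n := by
  have h : c.chainsVal A n a ∈ LinearMap.range (c.chainsVal A n) := ⟨a, rfl⟩
  rw [range_chainsVal] at h
  exact Finsupp.supported_mono (fun _ hσ => Exists.intro A ⟨hA, hσ⟩) h

theorem chainsVal_chainsInclusion {A B : Set X} (h : A ⊆ B) {n : ℕ}
    (x : SingularSimplex (c.subspace A) n →₀ ℤ) :
    c.chainsVal B n (c.chainsInclusion h n x) = c.chainsVal A n x :=
  (Finsupp.mapDomain_comp (f := SingularSimplex.push _ (c.isContinuous_inclusion h))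
    (g := SingularSimplex.push _ (c.isContinuous_val B))).symm

theorem chainsInclusion_injective {A B : Set X} (h : A ⊆ B) (n : ℕ) :
    Function.Injective (c.chainsInclusion h n) := fun x y hxy =>
  chainsVal_injective A n (by
    rw [← chainsVal_chainsInclusion h, hxy, chainsVal_chainsInclusion])

theorem boundary_chainsVal {A : Set X} {n : ℕ} (x : SingularSimplex (c.subspace A) (n + 1) →₀ ℤ) :
    c.boundary n (c.chainsVal A (n + 1) x) = c.chainsVal A n ((c.subspace A).boundary n x) :=
  LinearMap.congr_fun (boundary_mapDomain_push _ (c.isContinuous_val A) n) x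

theorem boundary_chainsInclusion {A B : Set X} (h : A ⊆ B) {n : ℕ}
    (x : SingularSimplex (c.subspace A) (n + 1) →₀ ℤ) :
    (c.subspace B).boundary n (c.chainsInclusion h (n + 1) x) =
      c.chainsInclusion h n ((c.subspace A).boundary n x) :=
  LinearMap.congr_fun (boundary_mapDomain_push _ (c.isContinuous_inclusion h) n) x

/-- Chains of `A` and of `B` with the same image in the chains of `X` come from `A ∩ B`. -/
theorem exists_chainsInclusion_eq {A B : Set X} {n : ℕ}
    {a : SingularSimplex (c.subspace A) n →₀ ℤ} {b : SingularSimplex (c.subspace B) n →₀ ℤ}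
    (h : c.chainsVal A n a = c.chainsVal B n b) :
    ∃ w, c.chainsInclusion (Set.inter_subset_left (s := A) (t := B)) n w = a ∧
      c.chainsInclusion Set.inter_subset_right n w = b := by
  have hA : c.chainsVal A n a ∈ LinearMap.range (c.chainsVal A n) := ⟨a, rfl⟩
  have hB : c.chainsVal A n a ∈ LinearMap.range (c.chainsVal B n) := ⟨b, h.symm⟩
  rw [range_chainsVal] at hA hB
  have hAB : c.chainsVal A n a ∈ LinearMap.range (c.chainsVal (A ∩ B) n) := by
    rw [range_chainsVal]
    simp only [Set.subset_inter_iff, Set.ofPred_and, Finsupp.supported_inter]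
    exact ⟨hA, hB⟩
  obtain ⟨w, hw⟩ := hAB
  refine ⟨w, chainsVal_injective A n ?_, chainsVal_injective B n ?_⟩
  · rw [chainsVal_chainsInclusion, hw]
  · rw [chainsVal_chainsInclusion, hw, h]

end Subspaces

end CechClosure

/-! ### The exact sequence -/

namespace CechClosure

section MayerVietoris

variable {X : Type u} {c : CechClosure X} {A B : Set X}

theorem mem_cycleChains_of_chainsInclusion (h : A ⊆ B) {n : ℕ}
    {x : SingularSimplex (c.subspace A) n →₀ ℤ}
    (hx : c.chainsInclusion h n x ∈ (c.subspace B).cycleChains n) :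
    x ∈ (c.subspace A).cycleChains n := by
  cases n with
  | zero => trivial
  | succ n =>
    refine chainsInclusion_injective h n ?_
    rw [map_zero, ← boundary_chainsInclusion]
    exact hx

theorem mvPsi_homologyClass_eq_iff (n : ℕ) (za : (c.subspace A).singularChains.cycles n)
    (zb : (c.subspace B).singularChains.cycles n) (z : c.singularChains.cycles n) :
    c.mvPsi A B n ((c.subspace A).homologyClass n za, (c.subspace B).homologyClass n zb) =
        c.homologyClass n z ↔
      ∃ y, c.boundary n y = c.chainsVal A n ((c.subspace A).cycleChain n za) +
        c.chainsVal B n ((c.subspace B).cycleChain n zb) - c.cycleChain n z := by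
  obtain ⟨za', ha⟩ := exists_cycleChain_eq n (mapDomain_push_mem_cycleChains
    (c.isContinuous_val A) (cycleChain_mem_cycleChains n za))
  obtain ⟨zb', hb⟩ := exists_cycleChain_eq n (mapDomain_push_mem_cycleChains
    (c.isContinuous_val B) (cycleChain_mem_cycleChains n zb))
  have h : c.mvPsi A B n ((c.subspace A).homologyClass n za, (c.subspace B).homologyClass n zb) =
      c.homologyClass n (za' + zb') := by
    rw [map_add]
    exact congrArg₂ (· + ·) (HMap_homologyClass _ n ha.symm) (HMap_homologyClass _ n hb.symm)
  rw [h, homologyClass_eq_iff, map_add, ha, hb]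
  rfl

theorem mvPhi_homologyClass_eq_iff (n : ℕ) (w : (c.subspace (A ∩ B)).singularChains.cycles n)
    (za : (c.subspace A).singularChains.cycles n) (zb : (c.subspace B).singularChains.cycles n) :
    c.mvPhi A B n ((c.subspace (A ∩ B)).homologyClass n w) =
        ((c.subspace A).homologyClass n za, (c.subspace B).homologyClass n zb) ↔
      (∃ y, (c.subspace A).boundary n y = c.chainsInclusion Set.inter_subset_left n
        ((c.subspace (A ∩ B)).cycleChain n w) - (c.subspace A).cycleChain n za) ∧
      ∃ y, (c.subspace B).boundary n y = c.chainsInclusion Set.inter_subset_right n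
        ((c.subspace (A ∩ B)).cycleChain n w) + (c.subspace B).cycleChain n zb := by
  rw [Prod.ext_iff]
  refine and_congr (HMap_homologyClass_eq_iff _ n w za) ?_
  refine neg_eq_iff_eq_neg.trans ?_
  rw [← map_neg]
  refine (HMap_homologyClass_eq_iff _ n w (-zb)).trans ?_
  rw [map_neg, sub_neg_eq_add]
  rfl

/-- If a sum of chains of `A` and of `B` bounds in `X`, then the two chains are, up to boundaries in
`A` and in `B`, opposite chains of `A ∩ B`. -/
theorem IsInteriorCover.exists_chainsInclusion_eq_sub_boundary (hAB : c.IsInteriorCover {A, B})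
    {n : ℕ} {a : SingularSimplex (c.subspace A) n →₀ ℤ}
    {b : SingularSimplex (c.subspace B) n →₀ ℤ} {y : SingularSimplex c (n + 1) →₀ ℤ}
    (h : c.boundary n y = c.chainsVal A n a + c.chainsVal B n b) :
    ∃ a' b' w, c.chainsInclusion (Set.inter_subset_left (s := A) (t := B)) n w =
        a - (c.subspace A).boundary n a' ∧
      c.chainsInclusion Set.inter_subset_right n w = (c.subspace B).boundary n b' - b := by
  have hy : c.boundary n y ∈ c.smallChains {A, B} n := by
    rw [h]
    exact add_mem (chainsVal_mem_smallChains (Or.inl rfl) a)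
      (chainsVal_mem_smallChains (Or.inr rfl) b)
  obtain ⟨u, hu⟩ := hAB.exists_sub_boundary_mem hy
  obtain ⟨a', b', h'⟩ := exists_eq_chainsVal_add hu
  have hd := congrArg (c.boundary n) h'
  rw [map_sub, show c.boundary n (c.boundary (n + 1) u) = 0 from
    LinearMap.congr_fun (c.boundary_comp_boundary n) u, sub_zero, h, map_add, boundary_chainsVal,
    boundary_chainsVal] at hd
  refine ⟨a', b', exists_chainsInclusion_eq ?_⟩
  rw [map_sub, map_sub, sub_eq_sub_iff_add_eq_add, hd]
  exact add_comm _ _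

/-- The relation between cycles that defines the connecting homomorphism: `z = a + b`, and `w` is
`∂a`. -/
def IsConnecting (A B : Set X) (n : ℕ) (z : c.singularChains.cycles (n + 1))
    (w : (c.subspace (A ∩ B)).singularChains.cycles n)
    (a : SingularSimplex (c.subspace A) (n + 1) →₀ ℤ)
    (b : SingularSimplex (c.subspace B) (n + 1) →₀ ℤ) : Prop :=
  c.cycleChain (n + 1) z = c.chainsVal A (n + 1) a + c.chainsVal B (n + 1) b ∧
    c.chainsInclusion Set.inter_subset_left n ((c.subspace (A ∩ B)).cycleChain n w) =
      (c.subspace A).boundary n a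

theorem IsConnecting.chainsInclusion_right {n : ℕ} {z : c.singularChains.cycles (n + 1)}
    {w : (c.subspace (A ∩ B)).singularChains.cycles n}
    {a : SingularSimplex (c.subspace A) (n + 1) →₀ ℤ}
    {b : SingularSimplex (c.subspace B) (n + 1) →₀ ℤ} (h : IsConnecting A B n z w a b) :
    c.chainsInclusion Set.inter_subset_right n ((c.subspace (A ∩ B)).cycleChain n w) =
      -(c.subspace B).boundary n b := by
  have hz : c.boundary n (c.cycleChain (n + 1) z) = 0 := cycleChain_mem_cycleChains (n + 1) z
  rw [h.1, map_add, boundary_chainsVal, boundary_chainsVal] at hz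
  refine chainsVal_injective B n ?_
  rw [chainsVal_chainsInclusion, ← chainsVal_chainsInclusion Set.inter_subset_left, h.2, map_neg]
  exact eq_neg_of_add_eq_zero_left hz

theorem IsInteriorCover.exists_isConnecting (hAB : c.IsInteriorCover {A, B}) (n : ℕ)
    (x : c.H (n + 1)) :
    ∃ z w a b, IsConnecting A B n z w a b ∧ c.homologyClass (n + 1) z = x := by
  obtain ⟨z₀, rfl⟩ := homologyClass_surjective (n + 1) x
  have hz₀ : c.boundary n (c.cycleChain (n + 1) z₀) = 0 := cycleChain_mem_cycleChains (n + 1) z₀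
  obtain ⟨y, hy⟩ := hAB.exists_sub_boundary_mem (hz₀ ▸ zero_mem (c.smallChains {A, B} n))
  obtain ⟨z, hz⟩ := exists_cycleChain_eq (n + 1)
    (sub_mem (cycleChain_mem_cycleChains (n + 1) z₀) (boundary_mem_cycleChains (n + 1) y))
  obtain ⟨a, b, hab⟩ := exists_eq_chainsVal_add hy
  have hd : c.boundary n (c.cycleChain (n + 1) z) = 0 := cycleChain_mem_cycleChains (n + 1) z
  rw [hz, hab, map_add, boundary_chainsVal, boundary_chainsVal, ← sub_neg_eq_add, sub_eq_zero,
    ← map_neg] at hd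
  obtain ⟨w₀, hwa, -⟩ := exists_chainsInclusion_eq hd
  obtain ⟨w, hw⟩ := exists_cycleChain_eq n (mem_cycleChains_of_chainsInclusion
    Set.inter_subset_left (hwa ▸ boundary_mem_cycleChains n a))
  refine ⟨z, w, a, b, ⟨hz.trans hab, hw ▸ hwa⟩, (homologyClass_eq_iff _ _ _).2 ⟨-y, ?_⟩⟩
  rw [hz, map_neg]
  abel

theorem IsInteriorCover.homologyClass_eq_zero_of_isConnecting (hAB : c.IsInteriorCover {A, B})
    {n : ℕ} {z : c.singularChains.cycles (n + 1)}
    {w : (c.subspace (A ∩ B)).singularChains.cycles n}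
    {a : SingularSimplex (c.subspace A) (n + 1) →₀ ℤ}
    {b : SingularSimplex (c.subspace B) (n + 1) →₀ ℤ} (h : IsConnecting A B n z w a b)
    (hz : c.homologyClass (n + 1) z = 0) : (c.subspace (A ∩ B)).homologyClass n w = 0 := by
  obtain ⟨y, hy⟩ := (homologyClass_eq_zero_iff _ _).1 hz
  obtain ⟨a', -, v, hv, -⟩ := hAB.exists_chainsInclusion_eq_sub_boundary (hy.trans h.1)
  refine (homologyClass_eq_zero_iff _ _).2 ⟨v, chainsInclusion_injective Set.inter_subset_left n ?_⟩
  rw [← boundary_chainsInclusion, hv, h.2, map_sub,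
    show (c.subspace A).boundary n ((c.subspace A).boundary (n + 1) a') = 0 from
      LinearMap.congr_fun ((c.subspace A).boundary_comp_boundary n) a', sub_zero]

theorem IsConnecting.sub {n : ℕ} {z z' : c.singularChains.cycles (n + 1)}
    {w w' : (c.subspace (A ∩ B)).singularChains.cycles n}
    {a a' : SingularSimplex (c.subspace A) (n + 1) →₀ ℤ}
    {b b' : SingularSimplex (c.subspace B) (n + 1) →₀ ℤ} (h : IsConnecting A B n z w a b)
    (h' : IsConnecting A B n z' w' a' b') :
    IsConnecting A B n (z - z') (w - w') (a - a') (b - b') := by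
  constructor
  · rw [map_sub, h.1, h'.1, map_sub, map_sub]
    abel
  · rw [map_sub, map_sub, h.2, h'.2, map_sub]

theorem IsConnecting.add {n : ℕ} {z z' : c.singularChains.cycles (n + 1)}
    {w w' : (c.subspace (A ∩ B)).singularChains.cycles n}
    {a a' : SingularSimplex (c.subspace A) (n + 1) →₀ ℤ}
    {b b' : SingularSimplex (c.subspace B) (n + 1) →₀ ℤ} (h : IsConnecting A B n z w a b)
    (h' : IsConnecting A B n z' w' a' b') :
    IsConnecting A B n (z + z') (w + w') (a + a') (b + b') := by
  constructor
  · rw [map_add, h.1, h'.1, map_add, map_add]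
    abel
  · rw [map_add, map_add, h.2, h'.2, map_add]

theorem IsInteriorCover.homologyClass_eq_of_isConnecting (hAB : c.IsInteriorCover {A, B})
    {n : ℕ} {z z' : c.singularChains.cycles (n + 1)}
    {w w' : (c.subspace (A ∩ B)).singularChains.cycles n}
    {a a' : SingularSimplex (c.subspace A) (n + 1) →₀ ℤ}
    {b b' : SingularSimplex (c.subspace B) (n + 1) →₀ ℤ} (h : IsConnecting A B n z w a b)
    (h' : IsConnecting A B n z' w' a' b')
    (hz : c.homologyClass (n + 1) z = c.homologyClass (n + 1) z') :
    (c.subspace (A ∩ B)).homologyClass n w = (c.subspace (A ∩ B)).homologyClass n w' := by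
  rw [← sub_eq_zero, ← map_sub]
  exact hAB.homologyClass_eq_zero_of_isConnecting (h.sub h') (by rw [map_sub, hz, sub_self])

/-- The connecting homomorphism exists: the class of `w` depends only on that of `z`. -/
theorem IsInteriorCover.exists_connectingHom (hAB : c.IsInteriorCover {A, B}) (n : ℕ) :
    ∃ δ : c.H (n + 1) →+ (c.subspace (A ∩ B)).H n, ∀ z w a b, IsConnecting A B n z w a b →
      δ (c.homologyClass (n + 1) z) = (c.subspace (A ∩ B)).homologyClass n w := by
  choose z w a b h hz using hAB.exists_isConnecting n
  refine ⟨AddMonoidHom.mk' (fun x => (c.subspace (A ∩ B)).homologyClass n (w x)) fun x y => ?_,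
    fun z' w' a' b' h' => ?_⟩
  · rw [← map_add]
    refine hAB.homologyClass_eq_of_isConnecting (h _) ((h x).add (h y)) ?_
    rw [map_add, hz, hz, hz]
  · exact hAB.homologyClass_eq_of_isConnecting (h _) h' (hz _)

theorem IsInteriorCover.exact_mvPhi_mvPsi (hAB : c.IsInteriorCover {A, B}) (n : ℕ) :
    Function.Exact (c.mvPhi A B n) (c.mvPsi A B n) := by
  rintro ⟨x, y⟩
  obtain ⟨za, rfl⟩ := homologyClass_surjective n x
  obtain ⟨zb, rfl⟩ := homologyClass_surjective n y
  rw [← map_zero (c.homologyClass n), mvPsi_homologyClass_eq_iff, map_zero]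
  constructor
  · rintro ⟨y, hy⟩
    obtain ⟨a', b', w₀, hwa, hwb⟩ :=
      hAB.exists_chainsInclusion_eq_sub_boundary (hy.trans (sub_zero _))
    obtain ⟨w, hw⟩ := exists_cycleChain_eq n (mem_cycleChains_of_chainsInclusion
      Set.inter_subset_left (hwa ▸ sub_mem (cycleChain_mem_cycleChains n za)
        (boundary_mem_cycleChains n a')))
    refine ⟨(c.subspace (A ∩ B)).homologyClass n w,
      (mvPhi_homologyClass_eq_iff n w za zb).2 ⟨⟨-a', ?_⟩, ⟨b', ?_⟩⟩⟩
    · rw [hw, hwa, map_neg]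
      abel
    · rw [hw, hwb, sub_add_cancel]
  · rintro ⟨x, hx⟩
    obtain ⟨w, rfl⟩ := homologyClass_surjective n x
    obtain ⟨⟨a', ha⟩, ⟨b', hb⟩⟩ := (mvPhi_homologyClass_eq_iff n w za zb).1 hx
    refine ⟨c.chainsVal B (n + 1) b' - c.chainsVal A (n + 1) a', ?_⟩
    rw [map_sub, boundary_chainsVal, boundary_chainsVal, ha, hb, map_sub, map_add,
      chainsVal_chainsInclusion, chainsVal_chainsInclusion]
    abel

theorem IsInteriorCover.exact_mvPsi_connecting (hAB : c.IsInteriorCover {A, B}) {n : ℕ}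
    {δ : c.H (n + 1) →+ (c.subspace (A ∩ B)).H n}
    (hδ : ∀ z w a b, IsConnecting A B n z w a b →
      δ (c.homologyClass (n + 1) z) = (c.subspace (A ∩ B)).homologyClass n w) :
    Function.Exact (c.mvPsi A B (n + 1)) δ := by
  intro x
  constructor
  · obtain ⟨z, w, a, b, h, rfl⟩ := hAB.exists_isConnecting n x
    rw [hδ z w a b h, homologyClass_eq_zero_iff]
    -- If `w = ∂v`, then `z = (a - v) + (b + v)` is a sum of cycles.
    rintro ⟨v, hv⟩
    obtain ⟨za, ha⟩ := exists_cycleChain_eq (c := c.subspace A) (n + 1)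
      (x := a - c.chainsInclusion Set.inter_subset_left (n + 1) v) (by
        rw [cycleChains, LinearMap.mem_ker, map_sub, boundary_chainsInclusion, hv, h.2, sub_self])
    obtain ⟨zb, hb⟩ := exists_cycleChain_eq (c := c.subspace B) (n + 1)
      (x := b + c.chainsInclusion Set.inter_subset_right (n + 1) v) (by
        rw [cycleChains, LinearMap.mem_ker, map_add, boundary_chainsInclusion, hv,
          h.chainsInclusion_right, add_neg_cancel])
    refine ⟨_, (mvPsi_homologyClass_eq_iff (n + 1) za zb z).2 ⟨0, ?_⟩⟩
    rw [ha, hb, h.1, map_sub, map_add, chainsVal_chainsInclusion, chainsVal_chainsInclusion,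
      map_zero]
    abel
  · rintro ⟨⟨x, y⟩, rfl⟩
    obtain ⟨za, rfl⟩ := homologyClass_surjective (n + 1) x
    obtain ⟨zb, rfl⟩ := homologyClass_surjective (n + 1) y
    obtain ⟨z, hz⟩ := exists_cycleChain_eq (n + 1) (add_mem
      (mapDomain_push_mem_cycleChains (c.isContinuous_val A)
        (cycleChain_mem_cycleChains (n + 1) za))
      (mapDomain_push_mem_cycleChains (c.isContinuous_val B)
        (cycleChain_mem_cycleChains (n + 1) zb)))
    rw [(mvPsi_homologyClass_eq_iff (n + 1) za zb z).2
      ⟨0, by rw [hz, map_zero]; exact (sub_self _).symm⟩,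
      hδ z 0 _ _ ⟨hz, ?_⟩, map_zero]
    rw [map_zero, map_zero]
    exact (cycleChain_mem_cycleChains (n + 1) za).symm

theorem IsInteriorCover.exact_connecting_mvPhi (hAB : c.IsInteriorCover {A, B}) {n : ℕ}
    {δ : c.H (n + 1) →+ (c.subspace (A ∩ B)).H n}
    (hδ : ∀ z w a b, IsConnecting A B n z w a b →
      δ (c.homologyClass (n + 1) z) = (c.subspace (A ∩ B)).homologyClass n w) :
    Function.Exact δ (c.mvPhi A B n) := by
  have hzero : (0 : (c.subspace A).H n × (c.subspace B).H n) =
      ((c.subspace A).homologyClass n 0, (c.subspace B).homologyClass n 0) := by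
    rw [map_zero, map_zero]; rfl
  intro x
  constructor
  · obtain ⟨w, rfl⟩ := homologyClass_surjective n x
    rw [hzero, mvPhi_homologyClass_eq_iff, map_zero, map_zero, sub_zero, add_zero]
    rintro ⟨⟨a, ha⟩, ⟨b, hb⟩⟩
    obtain ⟨z, hz⟩ := exists_cycleChain_eq (c := c) (n + 1)
      (x := c.chainsVal A (n + 1) a + c.chainsVal B (n + 1) (-b)) (by
        rw [cycleChains, LinearMap.mem_ker, map_add, boundary_chainsVal, boundary_chainsVal,
          map_neg, map_neg, ha, hb, chainsVal_chainsInclusion, chainsVal_chainsInclusion,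
          add_neg_cancel])
    exact ⟨c.homologyClass (n + 1) z, hδ z w a (-b) ⟨hz, ha.symm⟩⟩
  · rintro ⟨x, rfl⟩
    obtain ⟨z, w, a, b, h, rfl⟩ := hAB.exists_isConnecting n x
    rw [hδ z w a b h, hzero, mvPhi_homologyClass_eq_iff, map_zero, map_zero, sub_zero, add_zero]
    exact ⟨⟨a, h.2.symm⟩, ⟨-b, by rw [h.chainsInclusion_right, map_neg]⟩⟩

theorem IsInteriorCover.mvPsi_zero_surjective (hAB : c.IsInteriorCover {A, B}) :
    Function.Surjective (c.mvPsi A B 0) := by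
  intro x
  obtain ⟨z, rfl⟩ := homologyClass_surjective 0 x
  obtain ⟨a, b, hab⟩ := exists_eq_chainsVal_add
    (hAB.smallChains_zero.symm ▸ Submodule.mem_top : c.cycleChain 0 z ∈ c.smallChains {A, B} 0)
  obtain ⟨za, rfl⟩ := exists_cycleChain_eq (c := c.subspace A) 0 (x := a) trivial
  obtain ⟨zb, rfl⟩ := exists_cycleChain_eq (c := c.subspace B) 0 (x := b) trivial
  exact ⟨_, (mvPsi_homologyClass_eq_iff 0 za zb z).2 ⟨0, by rw [hab, map_zero, sub_self]⟩⟩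

end MayerVietoris

end CechClosure

theorem mainTheorem4 {X : Type u} (c : CechClosure X) (A B : Set X)
    (hAB : c.IsInteriorCover {A, B}) :
    ∃ δ : ∀ n : ℕ, c.H (n + 1) →+ (c.subspace (A ∩ B)).H n,
      (∀ n : ℕ, Function.Exact (c.mvPhi A B n) (c.mvPsi A B n)) ∧
      (∀ n : ℕ, Function.Exact (c.mvPsi A B (n + 1)) (δ n)) ∧
      (∀ n : ℕ, Function.Exact (δ n) (c.mvPhi A B n)) ∧
      Function.Surjective (c.mvPsi A B 0) ∧
      (∀ (n : ℕ) (z : c.singularChains.cycles (n + 1))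
        (w : (c.subspace (A ∩ B)).singularChains.cycles n)
        (a : (c.subspace A).SingularSimplex (n + 1) →₀ ℤ)
        (b : (c.subspace B).SingularSimplex (n + 1) →₀ ℤ),
        c.cycleChain (n + 1) z = c.chainsVal A (n + 1) a + c.chainsVal B (n + 1) b →
        c.chainsInclusion Set.inter_subset_left n ((c.subspace (A ∩ B)).cycleChain n w) =
          (c.subspace A).boundary n a →
        δ n (c.homologyClass (n + 1) z) = (c.subspace (A ∩ B)).homologyClass n w) := by
  choose δ hδ using hAB.exists_connectingHom
  exact ⟨δ, hAB.exact_mvPhi_mvPsi, fun n => hAB.exact_mvPsi_connecting (hδ n),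
    fun n => hAB.exact_connecting_mvPhi (hδ n), hAB.mvPsi_zero_surjective,
    fun n z w a b hz hw => hδ n z w a b ⟨hz, hw⟩⟩
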